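/- Let $\mathcal M=\langle \mathcal S,\mathcal A,\mathbf P,\mathcal R,\ell,\mathbf{AP},s_I\rangle$ be a Markov decision process whose state space $\mathcal S$ and action space $\mathcal A$ are separable metric spaces (metrics $d_{\mathcal S}, d_{\mathcal A}$) with their Borel $\sigma$-algebras, with Markov transition kernel $\mathbf P(\cdot\mid s,a)$, measurable reward function $\mathcal R:\mathcal S\times\mathcal A\to\mathbb R$, measurable labelling $\ell:\mathcal S\to 2^{\mathbf{AP}}$ and initial state $s_I$. Let $\mathrm{Im}(\mathcal R)$ carry a separable metric $d_{\mathcal R}$ whose Borel $\sigma$-algebra is the usual one. On transitions $(s,a,r,s')\in X=\mathcal S\times\mathcal A\times\mathrm{Im}(\mathcal R)\times\mathcal S$ put $$\vec d\big((s_1,a_1,r_1,s_1'),(s_2,a_2,r_2,s_2')\big)=d_{\mathcal S}(s_1,s_2)+d_{\mathcal A}(a_1,a_2)+d_{\mathcal R}(r_1,r_2)+d_{\mathcal S}(s_1',s_2'),$$ and for probability measures $P,Q$ on $X$ let $W_{\vec d}(P,Q)=\inf_{\lambda}\int \vec d\,d\lambda\in[0,\infty]$, the infimum being over all couplings $\lambda$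 of $P$ and $Q$. Let $\pi(\cdot\mid s)$ be a memoryless policy (a Markov kernel from $\mathcal S$ to $\mathcal A$), and let $\xi_\pi^t(\cdot\mid s)$ be the distribution of the state after $t$ steps of $\pi$ in $\mathcal M$ from $s$. Assume that the induced Markov chain is ergodic with stationary distribution $\xi_\pi$: $\xi_\pi$ is invariant, and $\xi_\pi^t(B\mid s)\to\xi_\pi(B)$ as $t\to\infty$ for every $s\in\mathcal S$ and every Borel set $B\subseteq\mathcal S$. Regard $\xi_\pi$ also as the distribution on $X$ of $(s,a,\mathcal R(s,a),s')$ with $s\sim\xi_\pi$, $a\sim\pi(\cdot\mid s)$, $s'\sim\mathbf P(\cdot\mid s,a)$. For $T\ge1$ let $$\mathcal D_\pi[T]=\frac1T\sum_{t=1}^T \mathrm{Law}\big(s,a,\mathcal R(s,a),s'\big),\qquad s\sim\xi^t_\pi(\cdot\mid s_I),\ a\sim\pi(\cdot\mid s),\ s'\sim\mathbf P(\cdot\mid s,a).$$ Let a behavioral model be given by distributions $\psi_\theta[t]$, $t\ge 1$, over traces $(s_0,\dots,s_t,\,a_0,\dots,a_{t-1},\,r_0,\dots,r_{t-1})$ of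 length $t$, with $s_i\in\mathcal S$, $a_i\in\mathcal A$, $r_i\in\mathrm{Im}(\mathcal R)$, and let $$\mathcal P_\theta[T]=\frac1T\sum_{t=1}^T \mathrm{Law}\big(s_{t-1},a_{t-1},r_{t-1},s_t\big)\quad\text{under }\psi_\theta[t].$$ Assume that a stationary behavioral model $\xi_\theta=\lim_{T\to\infty}\mathcal P_\theta[T]$ exists as a probability measure on $X$ (weak limit), and that the first moments of both families have negligible tails, i.e. for $\mu_T=\mathcal D_\pi[T]$ and for $\mu_T=\mathcal P_\theta[T]$, $$\lim_{r\to\infty}\limsup_{T\to\infty}\int_{\{x:\ \vec d(x_0,x)\ge r\}}\vec d(x_0,x)\,d\mu_T(x)=0\quad\text{for some } x_0\in X.$$ (This tail condition holds automatically if $d_{\mathcal S},d_{\mathcal A},d_{\mathcal R}$ are bounded.) Then $W_{\vec d}(\xi_\pi,\xi_\theta)<\infty$ and $$\lim_{T\to\infty}W_{\vec d}\big(\mathcal D_\pi[T],\mathcal P_\theta[T]\big)=W_{\vec d}(\xi_\pi,\xi_\theta).$$ -/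

import Mathlib

open MeasureTheory ProbabilityTheory Filter Topology
open scoped ENNReal

noncomputable section

/-! ### Markov decision processes -/

/-- A Markov decision process with state space `S`, action space `A` and atomic propositions `AP`:
a Markov kernel of transition probabilities, a real-valued reward function, a labelling function
and an initial state. -/
structure MDP (S A AP : Type*) [MeasurableSpace S] [MeasurableSpace A] where
  /-- `transition (s, a)` is the distribution `P(· ∣ s, a)` of the next state. -/
  transition : Kernel (S × A) S
  markov : IsMarkovKernel transition
  reward : S × A → ℝ
  measurable_reward : Measurable reward
  label : S → Set AP
  measurableSet_label : ∀ L : Set AP, MeasurableSet (label ⁻¹' {L})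
  init : S

attribute [instance] MDP.markov

namespace MDP

variable {S A AP : Type*} [MeasurableSpace S] [MeasurableSpace A]

/-- The image of the reward function. This is a definition rather than the bare subtype of `ℝ`,
so that it does not inherit the metric of `ℝ`: it can be equipped with any metric. -/
def RewardSpace (M : MDP S A AP) : Type := Set.range M.reward

instance (M : MDP S A AP) : MeasurableSpace M.RewardSpace :=
  inferInstanceAs (MeasurableSpace (Set.range M.reward))

/-- The reward function, with values in its image. -/
def rewardMap (M : MDP S A AP) (x : S × A) : M.RewardSpace := ⟨M.reward x, x, rfl⟩

theorem measurable_rewardMap (M : MDP S A AP) : Measurable M.rewardMap :=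
  Measurable.subtype_mk M.measurable_reward

/-- The space of transitions `(s, a, r, s')`. -/
abbrev Transition (M : MDP S A AP) : Type _ := S × A × M.RewardSpace × S

/-- The Markov chain on `S` obtained by running the memoryless policy `π` in `M`: from `s`, draw
`a ∼ π(· ∣ s)`, then the next state from `P(· ∣ s, a)`. -/
def chain (M : MDP S A AP) (π : Kernel S A) : Kernel S S :=
  M.transition ∘ₖ (Kernel.id ×ₖ π)

instance (M : MDP S A AP) (π : Kernel S A) [IsMarkovKernel π] : IsMarkovKernel (M.chain π) := by
  unfold chain; infer_instance

theorem isMarkovKernel_chain_pow (M : MDP S A AP) (π : Kernel S A) [IsMarkovKernel π] (t : ℕ) :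
    IsMarkovKernel (M.chain π ^ t) := by
  induction t with
  | zero => rw [pow_zero]; exact inferInstanceAs (IsMarkovKernel (Kernel.id : Kernel S S))
  | succ n ih =>
    rw [pow_succ]
    exact inferInstanceAs (IsMarkovKernel ((M.chain π ^ n) ∘ₖ M.chain π))

/-- `ξ_π^t(· ∣ s)`: the distribution of the state after `t` steps when `π` is run in `M` from `s`. -/
def stateDist (M : MDP S A AP) (π : Kernel S A) [IsMarkovKernel π] (t : ℕ) (s : S) :
    ProbabilityMeasure S :=
  ⟨(M.chain π ^ t) s, (M.isMarkovKernel_chain_pow π t).isProbabilityMeasure s⟩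

/-- `M_π` is ergodic with stationary distribution `ξ`: the distribution `ξ` is invariant, and
`ξ_π^t(B ∣ s) → ξ(B)` as `t → ∞` for every initial state `s` and every measurable `B`. -/
structure IsErgodicWith (M : MDP S A AP) (π : Kernel S A) [IsMarkovKernel π]
    (ξ : ProbabilityMeasure S) : Prop where
  invariant : Kernel.Invariant (M.chain π) (ξ : Measure S)
  tendsto : ∀ (s : S) (B : Set S), MeasurableSet B →
    Tendsto (fun t : ℕ => M.stateDist π t s B) atTop (𝓝 (ξ B))

/-- The distribution of the transition `(s, a, r, s')` when `s ∼ μ`, `a ∼ π(· ∣ s)`,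
`s' ∼ P(· ∣ s, a)` and `r = R(s, a)`. -/
def transitionDist (M : MDP S A AP) (π : Kernel S A) [IsMarkovKernel π]
    (μ : ProbabilityMeasure S) : ProbabilityMeasure M.Transition :=
  ProbabilityMeasure.map
    ⟨((μ : Measure S) ⊗ₘ π) ⊗ₘ M.transition, inferInstance⟩
    (f := fun x : (S × A) × S => (x.1.1, x.1.2, M.rewardMap x.1, x.2))
    (by have := M.measurable_rewardMap; fun_prop)

end MDP

/-! ### Distributions of the transitions that occur along traces -/

/-- The average `(1 / T) ∑_{t < T} μ t` of probability measures. -/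
def timeAverage {X : Type*} [MeasurableSpace X] (μ : ℕ → ProbabilityMeasure X) (T : ℕ+) :
    ProbabilityMeasure X :=
  ⟨((T : ℕ) : ℝ≥0∞)⁻¹ • ∑ t ∈ Finset.range T, (μ t : Measure X), ⟨by
    simp [ENNReal.inv_mul_cancel]⟩⟩

/-- Traces of length `t`: states `s_0, …, s_t`, actions `a_0, …, a_{t-1}` and rewards
`r_0, …, r_{t-1}`. -/
abbrev Trace (S A R : Type*) (t : ℕ) : Type _ := (Fin (t + 1) → S) × (Fin t → A) × (Fin t → R)

/-- The last transition `(s_t, a_t, r_t, s_{t+1})` of a trace of length `t + 1`. -/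
def Trace.lastTransition {S A R : Type*} {t : ℕ} (τ : Trace S A R (t + 1)) : S × A × R × S :=
  (τ.1 (Fin.last t).castSucc, τ.2.1 (Fin.last t), τ.2.2 (Fin.last t), τ.1 (Fin.last (t + 1)))

theorem Trace.measurable_lastTransition {S A R : Type*} [MeasurableSpace S] [MeasurableSpace A]
    [MeasurableSpace R] {t : ℕ} :
    Measurable (Trace.lastTransition : Trace S A R (t + 1) → S × A × R × S) := by
  unfold Trace.lastTransition; fun_prop

namespace MDP

variable {S A AP : Type*} [MeasurableSpace S] [MeasurableSpace A]

/-- A behavioral model `ψ` of `M`: for every `t`, a distribution `ψ[t]` over the traces of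
length `t` of states, actions and rewards of `M`. -/
abbrev BehavioralModel (M : MDP S A AP) : Type _ :=
  ∀ t : ℕ, ProbabilityMeasure (Trace S A M.RewardSpace t)

/-- `D_π[T] = (1 / T) ∑_{t = 1}^T` of the distributions of `(s, a, r, s')` with
`s ∼ ξ_π^t(· ∣ s_I)`, `a ∼ π(· ∣ s)`, `r = R(s, a)`, `s' ∼ P(· ∣ s, a)`. -/
def tracesDist (M : MDP S A AP) (π : Kernel S A) [IsMarkovKernel π] (T : ℕ+) :
    ProbabilityMeasure M.Transition :=
  timeAverage (fun t => M.transitionDist π (M.stateDist π (t + 1) M.init)) T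

/-- `P_ψ[T] = (1 / T) ∑_{t = 1}^T` of the distributions of the last transition
`(s_{t-1}, a_{t-1}, r_{t-1}, s_t)` of a trace drawn from `ψ[t]`. -/
def BehavioralModel.tracesDist {M : MDP S A AP} (ψ : M.BehavioralModel) (T : ℕ+) :
    ProbabilityMeasure M.Transition :=
  timeAverage (fun t => (ψ (t + 1)).map Trace.measurable_lastTransition.aemeasurable) T

/-- The raw transition distance: the sum of the distances of the four components. -/
def rawDist {M : MDP S A AP} [PseudoMetricSpace S] [PseudoMetricSpace A]
    [PseudoMetricSpace M.RewardSpace] (x y : M.Transition) : ℝ :=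
  dist x.1 y.1 + dist x.2.1 y.2.1 + dist x.2.2.1 y.2.2.1 + dist x.2.2.2 y.2.2.2

end MDP

/-! ### Optimal transport -/

/-- The couplings of `μ` and `ν`. -/
def couplings {X : Type*} [MeasurableSpace X] (μ ν : Measure X) : Set (Measure (X × X)) :=
  {γ | γ.map Prod.fst = μ ∧ γ.map Prod.snd = ν}

/-- The Wasserstein distance with respect to the distance `d`: the infimum over all couplings of
the expected distance (in `[0, ∞]`). -/
def wasserstein {X : Type*} [MeasurableSpace X] (d : X → X → ℝ) (μ ν : ProbabilityMeasure X) :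
    ℝ≥0∞ :=
  ⨅ γ ∈ couplings (μ : Measure X) (ν : Measure X), ∫⁻ z, ENNReal.ofReal (d z.1 z.2) ∂γ

/-- The first moments of the measures `μ T` have asymptotically negligible tails:
`lim_{r → ∞} limsup_{T → ∞} ∫_{d(x₀, x) ≥ r} d(x₀, x) dμ_T(x) = 0` for some `x₀`. Weak convergence
together with this property is weak convergence in the Wasserstein space of order one. If `d` is
bounded then the property holds for all `μ`. -/
def NegligibleMomentTails {X : Type*} [MeasurableSpace X] (d : X → X → ℝ)
    (μ : ℕ+ → ProbabilityMeasure X) : Prop :=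
  ∃ x₀ : X, ∀ ε : ℝ≥0∞, 0 < ε → ∃ r : ℝ, ∀ᶠ T in atTop,
    ∫⁻ x in {x | r ≤ d x₀ x}, ENNReal.ofReal (d x₀ x) ∂(μ T : Measure X) ≤ ε

end

/-! The Wasserstein distance `W` satisfies the triangle inequality, so `|W(μ_T, ν_T) - W(μ, ν)| ≤
W(μ_T, μ) + W(ν_T, ν)` as soon as `W(μ, ν)` is finite. It remains to see that both families converge
to their limits in `W` and that the limits have finite first moments.

For the traces of the policy, ergodicity is setwise convergence of the state laws. This passes
through the kernels `π` and `P` and through Cesàro means (`tendsto_compProd_apply`,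
`tendsto_timeAverage`), hence gives weak convergence; for the behavioral model weak convergence is
assumed. Weak convergence with negligible tails implies convergence in `W` (`tendsto_wasserstein`):
finitely many small cells with null boundary carry almost all the mass, the mass common to both
measures moves inside its cell, and the small remainder is sent through a base point at a cost
controlled by the tails. Finiteness of the first moments is lower semicontinuity
(`lintegral_ne_top_of_tendsto`).

Transitions form only a separable metric space, so couplings are not disintegrated and optimal ones
are not used. Gluing for the triangle inequality is done approximately, cell by cell along a
countable partition of the middle space (`exists_glue_of_partition`). -/

theorem MeasureTheory.Measure.inv_mul_smul_self {X : Type*} [MeasurableSpace X] {η : Measure X}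
    {m : ℝ≥0∞} (hη : η Set.univ = m) (hm : m ≠ ∞) : (m⁻¹ * m) • η = η := by
  -- A null cell carries the zero measure, so the convention `0⁻¹ * 0 = 0` does no harm and
  -- normalized products need no separate treatment of null cells.
  rcases eq_or_ne m 0 with rfl | h0
  · rw [Measure.measure_univ_eq_zero.1 hη, smul_zero]
  · rw [ENNReal.inv_mul_cancel h0 hm, one_smul]

/-! ### Continuous pseudodistances and partitions into small cells -/

/-- A continuous pseudodistance on a topological space. -/
structure IsContinuousPseudoDist {X : Type*} [TopologicalSpace X] (d : X → X → ℝ) : Prop where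
  self : ∀ x, d x x = 0
  symm : ∀ x y, d x y = d y x
  triangle : ∀ x y z, d x z ≤ d x y + d y z
  continuous : Continuous fun z : X × X => d z.1 z.2

namespace IsContinuousPseudoDist

variable {X : Type*} [TopologicalSpace X] {d : X → X → ℝ}

theorem nonneg (hd : IsContinuousPseudoDist d) (x y : X) : 0 ≤ d x y := by
  have := hd.triangle x y x
  rw [hd.self, hd.symm y x] at this
  linarith

theorem continuous_right (hd : IsContinuousPseudoDist d) (x : X) : Continuous (d x) :=
  hd.continuous.comp (by fun_prop : Continuous fun y : X => (x, y))

theorem ofReal_triangle (hd : IsContinuousPseudoDist d) (x y z : X) :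
    ENNReal.ofReal (d x z) ≤ ENNReal.ofReal (d x y) + ENNReal.ofReal (d y z) := by
  rw [← ENNReal.ofReal_add (hd.nonneg _ _) (hd.nonneg _ _)]
  exact ENNReal.ofReal_le_ofReal (hd.triangle x y z)

variable [MeasurableSpace X] [OpensMeasurableSpace X]

theorem measurable_right (hd : IsContinuousPseudoDist d) (x : X) :
    Measurable fun y => ENNReal.ofReal (d x y) :=
  (hd.continuous_right x).measurable.ennreal_ofReal

theorem measurable_left (hd : IsContinuousPseudoDist d) (x : X) :
    Measurable fun y => ENNReal.ofReal (d y x) := by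
  simpa only [hd.symm _ x] using hd.measurable_right x

theorem measurable_uncurry [SecondCountableTopology X] (hd : IsContinuousPseudoDist d) :
    Measurable fun z : X × X => ENNReal.ofReal (d z.1 z.2) :=
  hd.continuous.measurable.ennreal_ofReal

/-- Balls with respect to `d` whose boundary is a null set exist between any two radii. -/
theorem exists_null_frontier_ball (hd : IsContinuousPseudoDist d) (μ : Measure X) [SFinite μ]
    (x : X) {a b : ℝ} (hab : a < b) : ∃ r ∈ Set.Ioo a b, μ (frontier {y | d x y < r}) = 0 := by
  have hfr : ∀ r : ℝ, frontier {y | d x y < r} ⊆ {y | d x y = r} := fun r =>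
    frontier_lt_subset_eq (hd.continuous_right x) continuous_const
  -- The frontiers lie in disjoint spheres, so only countably many radii are bad, and these cannot
  -- fill an interval of positive length.
  have key := Measure.countable_meas_pos_of_disjoint_iUnion (μ := μ)
    (As := fun r : ℝ => frontier {y | d x y < r})
    (fun r => isClosed_frontier.measurableSet) (fun r s hrs => by
      refine Set.disjoint_left.2 fun y hy hy' => hrs ?_
      exact (hfr r hy).symm.trans (hfr s hy'))
  have aux := measure_sdiff_null (s := Set.Ioo a b) (Set.Countable.measure_zero key volume)
  have len_pos : 0 < ENNReal.ofReal (b - a) := by simp only [hab, ENNReal.ofReal_pos, sub_pos]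
  rw [← Real.volume_Ioo, ← aux] at len_pos
  simpa [Set.Nonempty] using nonempty_of_measure_ne_zero len_pos.ne'

/-- A partition of the space into countably many cells of small diameter with null boundary. -/
theorem exists_partition [SecondCountableTopology X]
    (hd : IsContinuousPseudoDist d) (μ : Measure X) [SFinite μ] {ε : ℝ} (hε : 0 < ε) :
    ∃ C : ℕ → Set X, (∀ n, MeasurableSet (C n)) ∧ Pairwise (Function.onFun Disjoint C) ∧
      (⋃ n, C n) = Set.univ ∧ (∀ n, ∀ x ∈ C n, ∀ y ∈ C n, d x y ≤ ε) ∧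
      ∀ n, μ (frontier (C n)) = 0 := by
  rcases isEmpty_or_nonempty X with hX | hX
  · exact ⟨fun _ => ∅, by simp, fun _ _ _ => by simp [Function.onFun], Subsingleton.elim _ _,
      by simp, by simp⟩
  -- Radii above `ε / 4` make the balls around a dense sequence cover the space; radii below `ε / 2`
  -- keep the diameters at most `ε`.
  choose r hr hr0 using fun n : ℕ =>
    hd.exists_null_frontier_ball μ (TopologicalSpace.denseSeq X n)
      (show ε / 4 < ε / 2 by linarith)
  set B : ℕ → Set X := fun n => {y | d (TopologicalSpace.denseSeq X n) y < r n} with hB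
  have hBo : ∀ n, IsOpen (B n) := fun n => isOpen_lt (hd.continuous_right _) continuous_const
  refine ⟨disjointed B, fun n => MeasurableSet.disjointed (fun n => (hBo n).measurableSet) n,
    disjoint_disjointed B, ?_, fun n x hx y hy => ?_, fun n => ?_⟩
  · rw [iUnion_disjointed, Set.eq_univ_iff_forall]
    intro y
    have ho : IsOpen {x | d y x < ε / 4} := isOpen_lt (hd.continuous_right _) continuous_const
    obtain ⟨x, hx, n, rfl⟩ := (TopologicalSpace.denseRange_denseSeq X).inter_open_nonempty _ ho
      ⟨y, by simp only [Set.mem_ofPred_eq, hd.self]; linarith⟩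
    refine Set.mem_iUnion.2 ⟨n, ?_⟩
    simp only [hB, Set.mem_ofPred_eq] at hx ⊢
    rw [hd.symm]
    exact hx.trans (hr n).1
  · have hx' := disjointed_le B n hx
    have hy' := disjointed_le B n hy
    simp only [hB, Set.mem_ofPred_eq] at hx' hy'
    have := hd.triangle x (TopologicalSpace.denseSeq X n) y
    rw [hd.symm x (TopologicalSpace.denseSeq X n)] at this
    linarith [(hr n).2]
  -- The cells arise by successive differences, and the frontier of a difference lies in the union
  -- of the two frontiers.
  · refine disjointedRec (p := fun s => μ (frontier s) = 0) (fun t i ht => ?_) (hr0 n)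
    refine measure_mono_null ?_ (measure_union_null ht (hr0 i))
    rw [Set.sdiff_eq]
    refine (frontier_inter_subset _ _).trans ?_
    rw [frontier_compl]
    exact Set.union_subset_union Set.inter_subset_left Set.inter_subset_right

/-! ### Symmetry, gluing and the triangle inequality -/

/-- The Wasserstein distance is symmetric. -/
theorem wasserstein_comm [SecondCountableTopology X] (hd : IsContinuousPseudoDist d)
    (μ ν : ProbabilityMeasure X) : wasserstein d μ ν = wasserstein d ν μ := by
  have key : ∀ μ ν : ProbabilityMeasure X, wasserstein d μ ν ≤ wasserstein d ν μ := by
    intro μ ν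
    refine le_iInf₂ fun γ hγ => ?_
    have hmem : γ.map Prod.swap ∈ couplings (μ : Measure X) (ν : Measure X) := by
      constructor
      · rw [Measure.map_map measurable_fst measurable_swap]; exact hγ.2
      · rw [Measure.map_map measurable_snd measurable_swap]; exact hγ.1
    refine (iInf₂_le _ hmem).trans ?_
    rw [lintegral_map hd.measurable_uncurry measurable_swap]
    exact le_of_eq (lintegral_congr fun z => by rw [Prod.fst_swap, Prod.snd_swap, hd.symm])
  exact le_antisymm (key _ _) (key _ _)

/-- The transport cost of a normalized product of measures of equal mass, routed through a point. -/
theorem inv_mul_lintegral_prod_le [SecondCountableTopology X] (hd : IsContinuousPseudoDist d)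
    {α β : Measure X} [SFinite α] [SFinite β] {m : ℝ≥0∞} (hα : α Set.univ = m)
    (hβ : β Set.univ = m) (p : X) :
    m⁻¹ * ∫⁻ z, ENNReal.ofReal (d z.1 z.2) ∂(α.prod β) ≤
      ∫⁻ x, ENNReal.ofReal (d x p) ∂α + ∫⁻ x, ENNReal.ofReal (d p x) ∂β := by
  have hl := hd.measurable_left p
  have hr := hd.measurable_right p
  have hl' : Measurable fun z : X × X => ENNReal.ofReal (d z.1 p) := hl.comp measurable_fst
  calc m⁻¹ * ∫⁻ z, ENNReal.ofReal (d z.1 z.2) ∂(α.prod β)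
      ≤ m⁻¹ * ∫⁻ z, (ENNReal.ofReal (d z.1 p) + ENNReal.ofReal (d p z.2)) ∂(α.prod β) := by
        gcongr
        exact hd.ofReal_triangle _ _ _
    _ = m⁻¹ * ((∫⁻ x, ENNReal.ofReal (d x p) ∂α) * m + (∫⁻ x, ENNReal.ofReal (d p x) ∂β) * m) := by
        rw [lintegral_add_left hl', ← lintegral_map hl measurable_fst,
          ← lintegral_map hr measurable_snd, Measure.map_fst_prod, Measure.map_snd_prod,
          hα, hβ, lintegral_smul_measure, lintegral_smul_measure, smul_eq_mul, smul_eq_mul]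
        ring
    _ = (m⁻¹ * m) * (∫⁻ x, ENNReal.ofReal (d x p) ∂α + ∫⁻ x, ENNReal.ofReal (d p x) ∂β) := by ring
    _ ≤ 1 * (∫⁻ x, ENNReal.ofReal (d x p) ∂α + ∫⁻ x, ENNReal.ofReal (d p x) ∂β) := by
        gcongr
        exact ENNReal.inv_mul_le_one _
    _ = _ := one_mul _

/-- Two couplings with a common marginal can be glued along a countable partition of the middle
space: the outer marginals are kept. -/
theorem exists_glue_of_partition [SecondCountableTopology X] (hd : IsContinuousPseudoDist d)
    {μ ν ρ : Measure X} [IsProbabilityMeasure ν]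
    {γ₁ γ₂ : Measure (X × X)} (h₁ : γ₁ ∈ couplings μ ν) (h₂ : γ₂ ∈ couplings ν ρ)
    {ε : ℝ} (hε : 0 < ε) :
    ∃ γ ∈ couplings μ ρ, ∫⁻ z, ENNReal.ofReal (d z.1 z.2) ∂γ ≤
      (∫⁻ z, ENNReal.ofReal (d z.1 z.2) ∂γ₁ + ENNReal.ofReal ε) +
      (∫⁻ z, ENNReal.ofReal (d z.1 z.2) ∂γ₂ + ENNReal.ofReal ε) := by
  have hX : Nonempty X := nonempty_of_isProbabilityMeasure ν
  have hp₁ : IsProbabilityMeasure γ₁ := 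
    (Measure.isProbabilityMeasure_map_iff measurable_snd.aemeasurable).1
      (by rw [h₁.2]; infer_instance)
  have hp₂ : IsProbabilityMeasure γ₂ := 
    (Measure.isProbabilityMeasure_map_iff measurable_fst.aemeasurable).1
      (by rw [h₂.1]; infer_instance)
  obtain ⟨C, hCm, hCd, hCu, hC, -⟩ := hd.exists_partition ν hε
  have hp : ∀ n, ∃ p, ∀ y ∈ C n, d y p ≤ ε := fun n => by
    rcases (C n).eq_empty_or_nonempty with h | ⟨p, hp⟩
    · exact ⟨hX.some, by simp [h]⟩
    · exact ⟨p, fun y hy => hC n y hy p hp⟩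
  choose p hp using hp
  set α : ℕ → Measure X := fun n => (γ₁.restrict (Prod.snd ⁻¹' C n)).map Prod.fst with hα
  set β : ℕ → Measure X := fun n => (γ₂.restrict (Prod.fst ⁻¹' C n)).map Prod.snd with hβ
  have hCm₁ : ∀ n, MeasurableSet (Prod.snd ⁻¹' C n : Set (X × X)) := fun n => measurable_snd (hCm n)
  have hCm₂ : ∀ n, MeasurableSet (Prod.fst ⁻¹' C n : Set (X × X)) := fun n => measurable_fst (hCm n)
  have hα1 : ∀ n, α n Set.univ = ν (C n) := fun n => by
    rw [hα, Measure.map_apply measurable_fst MeasurableSet.univ, ← h₁.2,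
      Measure.map_apply measurable_snd (hCm n)]
    simp
  have hβ1 : ∀ n, β n Set.univ = ν (C n) := fun n => by
    rw [hβ, Measure.map_apply measurable_snd MeasurableSet.univ, ← h₂.1,
      Measure.map_apply measurable_fst (hCm n)]
    simp
  have hu₁ : (⋃ n, Prod.snd ⁻¹' C n : Set (X × X)) = Set.univ := by
    rw [← Set.preimage_iUnion, hCu, Set.preimage_univ]
  have hu₂ : (⋃ n, Prod.fst ⁻¹' C n : Set (X × X)) = Set.univ := by
    rw [← Set.preimage_iUnion, hCu, Set.preimage_univ]
  have hd₁ : Pairwise (Function.onFun Disjoint fun n => (Prod.snd ⁻¹' C n : Set (X × X))) :=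
    fun i j hij => (hCd hij).preimage _
  have hd₂ : Pairwise (Function.onFun Disjoint fun n => (Prod.fst ⁻¹' C n : Set (X × X))) :=
    fun i j hij => (hCd hij).preimage _
  have hαs : Measure.sum α = μ := by
    rw [hα, ← Measure.map_sum measurable_fst.aemeasurable, ← Measure.restrict_iUnion hd₁ hCm₁, hu₁,
      Measure.restrict_univ, h₁.1]
  have hβs : Measure.sum β = ρ := by
    rw [hβ, ← Measure.map_sum measurable_snd.aemeasurable, ← Measure.restrict_iUnion hd₂ hCm₂, hu₂,
      Measure.restrict_univ, h₂.2]
  -- Given the cell of the middle point, the outer points are made independent. The middle point is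
  -- thus remembered only up to its cell, and routing through `p n` costs at most `ε` on each side.
  refine ⟨Measure.sum fun n => (ν (C n))⁻¹ • (α n).prod (β n), ⟨?_, ?_⟩, ?_⟩
  · rw [Measure.map_sum measurable_fst.aemeasurable, ← hαs]
    congr 1; funext n
    rw [Measure.map_smul, Measure.map_fst_prod, hβ1, smul_smul,
      Measure.inv_mul_smul_self (hα1 n) (measure_ne_top _ _)]
  · rw [Measure.map_sum measurable_snd.aemeasurable, ← hβs]
    congr 1; funext n
    rw [Measure.map_smul, Measure.map_snd_prod, hα1, smul_smul,
      Measure.inv_mul_smul_self (hβ1 n) (measure_ne_top _ _)]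
  · have hdm := hd.measurable_uncurry
    have e₁ : ∫⁻ z, ENNReal.ofReal (d z.1 z.2) ∂γ₁ + ENNReal.ofReal ε =
        ∑' n, ∫⁻ z in Prod.snd ⁻¹' C n, (ENNReal.ofReal (d z.1 z.2) + ENNReal.ofReal ε) ∂γ₁ := by
      rw [← lintegral_iUnion hCm₁ hd₁, hu₁, setLIntegral_univ, lintegral_add_left hdm]
      simp
    have e₂ : ∫⁻ z, ENNReal.ofReal (d z.1 z.2) ∂γ₂ + ENNReal.ofReal ε =
        ∑' n, ∫⁻ z in Prod.fst ⁻¹' C n, (ENNReal.ofReal (d z.1 z.2) + ENNReal.ofReal ε) ∂γ₂ := by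
      rw [← lintegral_iUnion hCm₂ hd₂, hu₂, setLIntegral_univ, lintegral_add_left hdm]
      simp
    rw [e₁, e₂, lintegral_sum_measure, ← ENNReal.tsum_add]
    refine ENNReal.tsum_le_tsum fun n => ?_
    have b₁ : ∫⁻ x, ENNReal.ofReal (d x (p n)) ∂α n ≤
        ∫⁻ z in Prod.snd ⁻¹' C n, (ENNReal.ofReal (d z.1 z.2) + ENNReal.ofReal ε) ∂γ₁ := by
      rw [hα, lintegral_map (hd.measurable_left _) measurable_fst]
      refine setLIntegral_mono (hdm.add_const _) fun z hz => ?_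
      refine (hd.ofReal_triangle _ z.2 _).trans ?_
      gcongr
      exact hp n _ hz
    have b₂ : ∫⁻ x, ENNReal.ofReal (d (p n) x) ∂β n ≤
        ∫⁻ z in Prod.fst ⁻¹' C n, (ENNReal.ofReal (d z.1 z.2) + ENNReal.ofReal ε) ∂γ₂ := by
      rw [hβ, lintegral_map (hd.measurable_right _) measurable_snd]
      refine setLIntegral_mono (hdm.add_const _) fun z hz => ?_
      refine (hd.ofReal_triangle _ z.1 _).trans ?_
      rw [add_comm, hd.symm (p n)]
      gcongr
      exact hp n _ hz
    rw [lintegral_smul_measure, smul_eq_mul]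
    exact (hd.inv_mul_lintegral_prod_le (hα1 n) (hβ1 n) (p n)).trans (add_le_add b₁ b₂)

/-- The triangle inequality for the Wasserstein distance; the space need not be complete. -/
theorem wasserstein_triangle [SecondCountableTopology X] (hd : IsContinuousPseudoDist d)
    (μ ν ρ : ProbabilityMeasure X) :
    wasserstein d μ ρ ≤ wasserstein d μ ν + wasserstein d ν ρ := by
  conv_rhs => rw [wasserstein, wasserstein]
  simp_rw [ENNReal.iInf_add, ENNReal.add_iInf]
  refine le_iInf₂ fun γ₁ h₁ => le_iInf₂ fun γ₂ h₂ => ?_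
  refine ENNReal.le_of_forall_pos_le_add fun ε hε _ => ?_
  obtain ⟨γ, hγ, hle⟩ := hd.exists_glue_of_partition h₁ h₂ (ε := ε / 2) (by positivity)
  refine (iInf₂_le γ hγ).trans (hle.trans (le_of_eq ?_))
  have : ENNReal.ofReal (ε / 2) + ENNReal.ofReal (ε / 2) = ε := by
    rw [← ENNReal.ofReal_add (by positivity) (by positivity), add_halves, ENNReal.ofReal_coe_nnreal]
  rw [add_add_add_comm, this]

end IsContinuousPseudoDist

/-! ### From weak convergence to Wasserstein convergence -/

namespace IsContinuousPseudoDist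

variable {X : Type*} [TopologicalSpace X] {d : X → X → ℝ}
variable [MeasurableSpace X] [OpensMeasurableSpace X]

/-- A measure on the product whose marginals are dominated by `μ` and `ν` extends to a coupling,
the residual masses being transported through `x₀`. -/
theorem wasserstein_le_of_map_le [SecondCountableTopology X] (hd : IsContinuousPseudoDist d)
    (μ ν : ProbabilityMeasure X) {γ : Measure (X × X)} (h₁ : γ.map Prod.fst ≤ μ)
    (h₂ : γ.map Prod.snd ≤ ν) (x₀ : X) :
    wasserstein d μ ν ≤ ∫⁻ z, ENNReal.ofReal (d z.1 z.2) ∂γ +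
      (∫⁻ x, ENNReal.ofReal (d x₀ x) ∂((μ : Measure X) - γ.map Prod.fst) +
        ∫⁻ x, ENNReal.ofReal (d x₀ x) ∂((ν : Measure X) - γ.map Prod.snd)) := by
  have i₁ : IsFiniteMeasure (γ.map Prod.fst) := isFiniteMeasure_of_le _ h₁
  have i₂ : IsFiniteMeasure (γ.map Prod.snd) := isFiniteMeasure_of_le _ h₂
  set α := (μ : Measure X) - γ.map Prod.fst with hα
  set β := (ν : Measure X) - γ.map Prod.snd with hβ
  have hα1 : α Set.univ = 1 - γ Set.univ := by
    rw [hα, Measure.sub_apply MeasurableSet.univ h₁, measure_univ,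
      Measure.map_apply measurable_fst MeasurableSet.univ, Set.preimage_univ]
  have hβ1 : β Set.univ = 1 - γ Set.univ := by
    rw [hβ, Measure.sub_apply MeasurableSet.univ h₂, measure_univ,
      Measure.map_apply measurable_snd MeasurableSet.univ, Set.preimage_univ]
  have hm : 1 - γ Set.univ ≠ ∞ := ENNReal.sub_ne_top ENNReal.one_ne_top
  -- The two residuals have equal mass, so their normalized product has them as marginals.
  have hmem : γ + (1 - γ Set.univ)⁻¹ • α.prod β ∈ couplings (μ : Measure X) (ν : Measure X) := by
    constructor
    · rw [Measure.map_add _ _ measurable_fst, Measure.map_smul, Measure.map_fst_prod, hβ1,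
        smul_smul, Measure.inv_mul_smul_self hα1 hm, add_comm, hα, Measure.sub_add_cancel_of_le h₁]
    · rw [Measure.map_add _ _ measurable_snd, Measure.map_smul, Measure.map_snd_prod, hα1,
        smul_smul, Measure.inv_mul_smul_self hβ1 hm, add_comm, hβ, Measure.sub_add_cancel_of_le h₂]
  refine (iInf₂_le _ hmem).trans ?_
  rw [lintegral_add_measure, lintegral_smul_measure, smul_eq_mul]
  gcongr
  simpa only [hd.symm _ x₀] using hd.inv_mul_lintegral_prod_le hα1 hβ1 x₀

/-- The first moment of a measure is bounded by its mass and the tail of a larger measure. -/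
theorem lintegral_le_mul_add_tail (hd : IsContinuousPseudoDist d) {μ ρ : Measure X} (h : ρ ≤ μ)
    (x₀ : X) (r : ℝ) :
    ∫⁻ x, ENNReal.ofReal (d x₀ x) ∂ρ ≤ ENNReal.ofReal r * ρ Set.univ +
      ∫⁻ x in {x | r ≤ d x₀ x}, ENNReal.ofReal (d x₀ x) ∂μ := by
  have hm : MeasurableSet {x | r ≤ d x₀ x} :=
    measurableSet_le measurable_const (hd.continuous_right x₀).measurable
  refine le_trans ?_ (add_le_add_right (lintegral_mono' (Measure.restrict_mono_measure h _) le_rfl)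
    _)
  rw [← lintegral_const, ← lintegral_indicator hm, ← lintegral_add_left measurable_const]
  refine lintegral_mono fun x => ?_
  by_cases hx : r ≤ d x₀ x
  · rw [Set.indicator_of_mem (show x ∈ {x | r ≤ d x₀ x} from hx)]
    exact le_add_self
  · exact (ENNReal.ofReal_le_ofReal (not_le.1 hx).le).trans le_self_add

/-- Measures that assign similar masses to the cells of a fine partition are close in the
Wasserstein distance, up to tails of first moments. -/
theorem wasserstein_le_of_cells [SecondCountableTopology X] (hd : IsContinuousPseudoDist d)
    (μ ν : ProbabilityMeasure X) {C : ℕ → Set X} (hCm : ∀ n, MeasurableSet (C n))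
    (hCd : Pairwise (Function.onFun Disjoint C)) {ε : ℝ}
    (hC : ∀ n, ∀ x ∈ C n, ∀ y ∈ C n, d x y ≤ ε) (x₀ : X) (r : ℝ) (N : ℕ) :
    wasserstein d μ ν ≤ ENNReal.ofReal ε +
      (ENNReal.ofReal r * (1 - ∑ i ∈ Finset.range N,
          min ((μ : Measure X) (C i)) ((ν : Measure X) (C i))) +
        ∫⁻ x in {x | r ≤ d x₀ x}, ENNReal.ofReal (d x₀ x) ∂(μ : Measure X) +
      (ENNReal.ofReal r * (1 - ∑ i ∈ Finset.range N,
          min ((μ : Measure X) (C i)) ((ν : Measure X) (C i))) +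
        ∫⁻ x in {x | r ≤ d x₀ x}, ENNReal.ofReal (d x₀ x) ∂(ν : Measure X))) := by
  -- With this weight the product over a cell has mass `μ ν / max = min`, the common mass, while its
  -- marginals are the restrictions of `μ` and `ν` scaled by factors at most one.
  set k : ℕ → ℝ≥0∞ := fun i => (max ((μ : Measure X) (C i)) ((ν : Measure X) (C i)))⁻¹ with hk
  set γ : Measure (X × X) := ∑ i ∈ Finset.range N,
    k i • ((μ : Measure X).restrict (C i)).prod ((ν : Measure X).restrict (C i)) with hγ
  have hsum : ∀ (η : Measure X) (a : ℕ → ℝ≥0∞), (∀ i, a i ≤ 1) →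
      ∑ i ∈ Finset.range N, a i • η.restrict (C i) ≤ η := by
    intro η a ha
    refine Measure.le_iff.2 fun s hs => ?_
    rw [Measure.finsetSum_apply]
    calc ∑ i ∈ Finset.range N, (a i • η.restrict (C i)) s
        ≤ ∑ i ∈ Finset.range N, η (s ∩ C i) := by
          refine Finset.sum_le_sum fun i _ => ?_
          rw [Measure.smul_apply, smul_eq_mul, Measure.restrict_apply hs]
          exact mul_le_of_le_one_left' (ha i)
      _ = η (⋃ i ∈ Finset.range N, s ∩ C i) := by
          refine (measure_biUnion_finset (fun i _ j _ hij => ?_) fun i _ => hs.inter (hCm i)).symm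
          exact (hCd hij).mono Set.inter_subset_right Set.inter_subset_right
      _ ≤ η s := measure_mono (Set.iUnion₂_subset fun i _ => Set.inter_subset_left)
  have hkμ : ∀ i, k i * (μ : Measure X) (C i) ≤ 1 := fun i =>
    (mul_le_mul_right (le_max_left _ _) _).trans (ENNReal.inv_mul_le_one _)
  have hkν : ∀ i, k i * (ν : Measure X) (C i) ≤ 1 := fun i =>
    (mul_le_mul_right (le_max_right _ _) _).trans (ENNReal.inv_mul_le_one _)
  have h₁ : γ.map Prod.fst ≤ μ := by
    rw [hγ, Measure.map_finset_sum measurable_fst.aemeasurable]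
    refine le_trans (le_of_eq (Finset.sum_congr rfl fun i _ => ?_)) (hsum μ _ hkν)
    rw [Measure.map_smul, Measure.map_fst_prod, smul_smul, Measure.restrict_apply_univ]
  have h₂ : γ.map Prod.snd ≤ ν := by
    rw [hγ, Measure.map_finset_sum measurable_snd.aemeasurable]
    refine le_trans (le_of_eq (Finset.sum_congr rfl fun i _ => ?_)) (hsum ν _ hkμ)
    rw [Measure.map_smul, Measure.map_snd_prod, smul_smul, Measure.restrict_apply_univ]
  have i₁ : IsFiniteMeasure (γ.map Prod.fst) := isFiniteMeasure_of_le _ h₁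
  have i₂ : IsFiniteMeasure (γ.map Prod.snd) := isFiniteMeasure_of_le _ h₂
  have hγ1 : γ Set.univ ≤ 1 := by
    rw [← Set.preimage_univ (f := (Prod.fst : X × X → X)),
      ← Measure.map_apply measurable_fst MeasurableSet.univ]
    exact (h₁ Set.univ).trans prob_le_one
  have hmass : ∑ i ∈ Finset.range N, min ((μ : Measure X) (C i)) ((ν : Measure X) (C i)) =
      γ Set.univ := by
    rw [hγ, Measure.finsetSum_apply]
    refine Finset.sum_congr rfl fun i _ => ?_
    rw [Measure.smul_apply, smul_eq_mul, ← Set.univ_prod_univ, Measure.prod_prod,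
      Measure.restrict_apply_univ, Measure.restrict_apply_univ,
      ← min_mul_max ((μ : Measure X) (C i)), hk, mul_comm, mul_assoc]
    rcases eq_or_ne (max ((μ : Measure X) (C i)) ((ν : Measure X) (C i))) 0 with h0 | h0
    · rw [h0, zero_mul, mul_zero]
      exact le_antisymm ((min_le_max).trans h0.le) zero_le
    · rw [ENNReal.mul_inv_cancel h0 (max_lt (measure_lt_top _ _) (measure_lt_top _ _)).ne, mul_one]
  have hcost : ∫⁻ z, ENNReal.ofReal (d z.1 z.2) ∂γ ≤ ENNReal.ofReal ε := by
    calc ∫⁻ z, ENNReal.ofReal (d z.1 z.2) ∂γ ≤ ∫⁻ z, ENNReal.ofReal ε ∂γ := by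
          rw [hγ, lintegral_finsetSum_measure, lintegral_finsetSum_measure]
          refine Finset.sum_le_sum fun i _ => ?_
          rw [lintegral_smul_measure, lintegral_smul_measure, Measure.prod_restrict]
          gcongr ?_ • ?_
          refine setLIntegral_mono measurable_const fun z hz => ?_
          exact ENNReal.ofReal_le_ofReal (hC i _ hz.1 _ hz.2)
      _ ≤ ENNReal.ofReal ε := by
          rw [lintegral_const]
          exact mul_le_of_le_one_right' hγ1
  rw [hmass]
  refine (hd.wasserstein_le_of_map_le μ ν h₁ h₂ x₀).trans ?_
  have t₁ := hd.lintegral_le_mul_add_tail (Measure.sub_le : (μ : Measure X) - γ.map Prod.fst ≤ μ)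
    x₀ r
  have t₂ := hd.lintegral_le_mul_add_tail (Measure.sub_le : (ν : Measure X) - γ.map Prod.snd ≤ ν)
    x₀ r
  rw [Measure.sub_apply MeasurableSet.univ h₁, measure_univ,
    Measure.map_apply measurable_fst MeasurableSet.univ, Set.preimage_univ] at t₁
  rw [Measure.sub_apply MeasurableSet.univ h₂, measure_univ,
    Measure.map_apply measurable_snd MeasurableSet.univ, Set.preimage_univ] at t₂
  exact add_le_add hcost (add_le_add t₁ t₂)

/-- The first moment of a weak limit is finite if the tails of first moments are bounded. -/
theorem lintegral_ne_top_of_tendsto [HasOuterApproxClosed X] (hd : IsContinuousPseudoDist d)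
    {μs : ℕ → ProbabilityMeasure X} {μ : ProbabilityMeasure X}
    (hμ : Tendsto μs atTop (𝓝 μ)) {x₀ : X} {r : ℝ} {ε : ℝ≥0∞} (hε : ε ≠ ∞)
    (hr : ∀ᶠ n in atTop,
      ∫⁻ x in {x | r ≤ d x₀ x}, ENNReal.ofReal (d x₀ x) ∂(μs n : Measure X) ≤ ε) :
    ∫⁻ x, ENNReal.ofReal (d x₀ x) ∂(μ : Measure X) ≠ ∞ := by
  -- Lower semicontinuity of the first moment; along the sequence it is eventually at most `r + ε`.
  have h := lintegral_le_liminf_lintegral_of_forall_isOpen_measure_le_liminf_measure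
    (hd.continuous_right x₀) (hd.nonneg x₀)
    fun G hG => ProbabilityMeasure.le_liminf_measure_open_of_tendsto hμ hG
  refine ne_top_of_le_ne_top (b := ENNReal.ofReal r + ε) (by finiteness) (h.trans ?_)
  refine liminf_le_of_frequently_le' (Eventually.frequently ?_)
  filter_upwards [hr] with n hn
  refine (hd.lintegral_le_mul_add_tail (μ := μs n) le_rfl x₀ r).trans ?_
  rw [measure_univ, mul_one]
  gcongr

theorem exists_lintegral_ne_top_of_negligibleMomentTails [HasOuterApproxClosed X]
    (hd : IsContinuousPseudoDist d)
    {μs : ℕ+ → ProbabilityMeasure X} {μ : ProbabilityMeasure X} (hμ : Tendsto μs atTop (𝓝 μ))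
    (htail : NegligibleMomentTails d μs) :
    ∃ x₀, ∫⁻ x, ENNReal.ofReal (d x₀ x) ∂(μ : Measure X) ≠ ∞ := by
  obtain ⟨x₀, hx₀⟩ := htail
  obtain ⟨r, hr⟩ := hx₀ 1 one_pos
  have hu : Tendsto Nat.succPNat atTop atTop :=
    tendsto_atTop.2 fun b => (eventually_ge_atTop (b : ℕ)).mono fun n hn =>
      (PNat.coe_le_coe _ _).1 (hn.trans n.le_succ)
  exact ⟨x₀, hd.lintegral_ne_top_of_tendsto (hμ.comp hu) ENNReal.one_ne_top (hu.eventually hr)⟩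

/-- A finite first moment has small tails. -/
theorem exists_tail_le (hd : IsContinuousPseudoDist d) {μ : Measure X} [IsFiniteMeasure μ] {x₀ : X}
    (hμ : ∫⁻ x, ENNReal.ofReal (d x₀ x) ∂μ ≠ ∞) {ε : ℝ≥0∞} (hε : 0 < ε) :
    ∃ r : ℝ, ∫⁻ x in {x | r ≤ d x₀ x}, ENNReal.ofReal (d x₀ x) ∂μ ≤ ε := by
  have hm : ∀ r : ℝ, MeasurableSet {x | r ≤ d x₀ x} := fun r =>
    measurableSet_le measurable_const (hd.continuous_right x₀).measurable
  have h0 : Tendsto (fun n : ℕ => μ {x | (n : ℝ) ≤ d x₀ x}) atTop (𝓝 0) := by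
    have h := tendsto_measure_iInter_atTop (μ := μ) (s := fun n : ℕ => {x | (n : ℝ) ≤ d x₀ x})
      (fun n => (hm n).nullMeasurableSet)
      (fun m n hmn x (hx : (n : ℝ) ≤ d x₀ x) =>
        show (m : ℝ) ≤ d x₀ x from le_trans (by exact_mod_cast hmn) hx) ⟨0, measure_ne_top _ _⟩
    have he : (⋂ n : ℕ, {x | (n : ℝ) ≤ d x₀ x}) = ∅ := by
      refine Set.eq_empty_of_forall_notMem fun x hx => ?_
      obtain ⟨n, hn⟩ := exists_nat_gt (d x₀ x)
      exact absurd (Set.mem_iInter.1 hx n) (not_le.2 hn)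
    rwa [he, measure_empty] at h
  -- Absolute continuity of the integral, applied to tail sets that decrease to the empty set.
  obtain ⟨n, hn⟩ := ((tendsto_setLIntegral_zero hμ h0).eventually_le_const hε).exists
  exact ⟨n, hn⟩

/-- Weak convergence with negligible tails of first moments is convergence in the Wasserstein
distance; the space need not be complete. -/
theorem tendsto_wasserstein [SecondCountableTopology X] [HasOuterApproxClosed X]
    (hd : IsContinuousPseudoDist d)
    {μs : ℕ → ProbabilityMeasure X} {μ : ProbabilityMeasure X}
    (hμ : Tendsto μs atTop (𝓝 μ)) {x₀ : X}
    (htail : ∀ ε : ℝ≥0∞, 0 < ε → ∃ r : ℝ, ∀ᶠ n in atTop,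
      ∫⁻ x in {x | r ≤ d x₀ x}, ENNReal.ofReal (d x₀ x) ∂(μs n : Measure X) ≤ ε) :
    Tendsto (fun n => wasserstein d (μs n) μ) atTop (𝓝 0) := by
  have hfin : ∫⁻ x, ENNReal.ofReal (d x₀ x) ∂(μ : Measure X) ≠ ∞ := by
    obtain ⟨r, hr⟩ := htail 1 one_pos
    exact hd.lintegral_ne_top_of_tendsto hμ ENNReal.one_ne_top hr
  -- One `ε` pays for the cell diameter; each of the two measures contributes one for its residual
  -- mass and one for its tail.
  have key : ∀ ε : NNReal, 0 < ε → ∀ᶠ n in atTop, wasserstein d (μs n) μ ≤ 5 * ε := by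
    intro ε hε
    have hε' : (0 : ℝ≥0∞) < ε := by exact_mod_cast hε
    obtain ⟨r₁, hr₁⟩ := htail ε hε'
    obtain ⟨r₂, hr₂⟩ := hd.exists_tail_le hfin hε'
    obtain ⟨C, hCm, hCd, hCu, hC, hC0⟩ := hd.exists_partition (μ : Measure X) (ε := ε) hε
    set r := max r₁ r₂ with hr
    -- The radius is fixed before the number of cells, since the mass left over is multiplied by
    -- `r`.
    have hN : Tendsto (fun N => ENNReal.ofReal r * (1 - ∑ i ∈ Finset.range N, (μ : Measure X) (C i)))
        atTop (𝓝 0) := by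
      have h1 : Tendsto (fun N => ∑ i ∈ Finset.range N, (μ : Measure X) (C i)) atTop (𝓝 1) := by
        have := (ENNReal.summable (f := fun i => (μ : Measure X) (C i))).hasSum.tendsto_sum_nat
        rwa [← measure_iUnion hCd hCm, hCu, measure_univ] at this
      have h2 := ENNReal.Tendsto.sub (tendsto_const_nhds (x := (1 : ℝ≥0∞))) h1
        (Or.inl ENNReal.one_ne_top)
      have h3 := ENNReal.Tendsto.const_mul h2 (Or.inr (ENNReal.ofReal_ne_top (r := r)))
      simpa using h3
    obtain ⟨N, hN⟩ := (hN.eventually_lt_const hε').exists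
    have hn : Tendsto (fun n => ENNReal.ofReal r * (1 - ∑ i ∈ Finset.range N,
        min ((μs n : Measure X) (C i)) ((μ : Measure X) (C i)))) atTop
        (𝓝 (ENNReal.ofReal r * (1 - ∑ i ∈ Finset.range N, (μ : Measure X) (C i)))) := by
      refine ENNReal.Tendsto.const_mul (ENNReal.Tendsto.sub tendsto_const_nhds
        (tendsto_finsetSum _ fun i _ => ?_) (Or.inl ENNReal.one_ne_top))
        (Or.inr ENNReal.ofReal_ne_top)
      -- Null boundaries are needed here: they make the mass of each cell converge.
      have := (ProbabilityMeasure.tendsto_measure_of_null_frontier_of_tendsto' hμ (hC0 i)).min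
        (tendsto_const_nhds (x := (μ : Measure X) (C i)))
      rwa [min_self] at this
    have hsub : ∀ (η : Measure X) (r' : ℝ), r' ≤ r →
        ∫⁻ x in {x | r ≤ d x₀ x}, ENNReal.ofReal (d x₀ x) ∂η ≤
          ∫⁻ x in {x | r' ≤ d x₀ x}, ENNReal.ofReal (d x₀ x) ∂η := fun η r' hr' =>
      lintegral_mono_set fun x hx => hr'.trans hx
    filter_upwards [hn.eventually_lt_const hN, hr₁] with n h1 h2
    refine (hd.wasserstein_le_of_cells (μs n) μ hCm hCd hC x₀ r N).trans ?_
    calc _ ≤ (ε : ℝ≥0∞) + ((ε + ε) + (ε + ε)) := by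
          refine add_le_add (by simp) (add_le_add (add_le_add h1.le ?_) (add_le_add h1.le ?_))
          · exact (hsub _ _ (le_max_left _ _)).trans h2
          · exact (hsub _ _ (le_max_right _ _)).trans hr₂
      _ = 5 * ε := by ring
  rw [ENNReal.tendsto_nhds_zero]
  intro ε hε
  obtain ⟨δ, hδ, hδε⟩ := ENNReal.lt_iff_exists_nnreal_btwn.1
    (ENNReal.div_pos hε.ne' (by norm_num : (5 : ℝ≥0∞) ≠ ∞))
  filter_upwards [key δ (by exact_mod_cast hδ)] with n hn
  refine hn.trans ((mul_le_mul_right hδε.le 5).trans ?_)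
  rw [ENNReal.mul_div_cancel (by norm_num) (by norm_num)]

end IsContinuousPseudoDist

/-! ### Setwise convergence, kernels and time averages -/

section Setwise

/-- Setwise convergence implies convergence of the integrals of bounded measurable functions. -/
theorem tendsto_lintegral_of_forall_tendsto_measure {X : Type*} [MeasurableSpace X]
    {μs : ℕ → Measure X} [∀ n, IsProbabilityMeasure (μs n)] {μ : Measure X}
    (h : ∀ B, MeasurableSet B → Tendsto (fun n => μs n B) atTop (𝓝 (μ B)))
    {g : X → ℝ≥0∞} (hg : Measurable g) (hg1 : ∀ x, g x ≤ 1) :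
    Tendsto (fun n => ∫⁻ x, g x ∂μs n) atTop (𝓝 (∫⁻ x, g x ∂μ)) := by
  -- The layer-cake formula turns the claim into dominated convergence in the level `t`, as the
  -- superlevel sets are empty for `t ≥ 1`.
  have hgr : ∀ η : Measure X, ∫⁻ x, g x ∂η =
      ∫⁻ t in Set.Ioi (0 : ℝ), η {x | t < (g x).toReal} := fun η => by
    rw [← lintegral_eq_lintegral_meas_lt η (Eventually.of_forall fun x => ENNReal.toReal_nonneg)
      hg.ennreal_toReal.aemeasurable]
    exact lintegral_congr fun x =>
      (ENNReal.ofReal_toReal (ne_top_of_le_ne_top ENNReal.one_ne_top (hg1 x))).symm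
  simp_rw [hgr]
  refine tendsto_lintegral_of_dominated_convergence ((Set.Iio (1 : ℝ)).indicator 1)
    (fun n => Antitone.measurable fun s t hst => measure_mono fun x hx => lt_of_le_of_lt hst hx)
    (fun n => Eventually.of_forall fun t => ?_) ?_
    (Eventually.of_forall fun t => h _ (measurableSet_lt measurable_const hg.ennreal_toReal))
  · by_cases ht : t < 1
    · rw [Set.indicator_of_mem (show t ∈ Set.Iio 1 from ht)]
      exact prob_le_one
    · have : {x | t < (g x).toReal} = ∅ := by
        refine Set.eq_empty_of_forall_notMem fun x hx => ht ?_
        exact lt_of_lt_of_le hx (ENNReal.toReal_le_of_le_ofReal zero_le_one (by simpa using hg1 x))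
      refine le_of_eq_of_le ?_ zero_le
      simp only [this, measure_empty]
  · rw [lintegral_indicator_one measurableSet_Iio, Measure.restrict_apply measurableSet_Iio,
      Set.inter_comm, Set.Ioi_inter_Iio, Real.volume_Ioo]
    exact ENNReal.ofReal_ne_top

/-- Setwise convergence is preserved by composition-products with a Markov kernel. -/
theorem tendsto_compProd_apply {X Y : Type*} [MeasurableSpace X] [MeasurableSpace Y]
    {μs : ℕ → Measure X} [∀ n, IsProbabilityMeasure (μs n)] {μ : Measure X} [SFinite μ]
    (h : ∀ B, MeasurableSet B → Tendsto (fun n => μs n B) atTop (𝓝 (μ B)))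
    (κ : Kernel X Y) [IsMarkovKernel κ] {B : Set (X × Y)} (hB : MeasurableSet B) :
    Tendsto (fun n => (μs n ⊗ₘ κ) B) atTop (𝓝 ((μ ⊗ₘ κ) B)) := by
  simp_rw [Measure.compProd_apply hB]
  exact tendsto_lintegral_of_forall_tendsto_measure h
    (Kernel.measurable_kernel_prodMk_left hB) fun x => prob_le_one

/-- The time averages of a setwise convergent sequence converge weakly. -/
theorem tendsto_timeAverage {X : Type*} [MeasurableSpace X] [TopologicalSpace X]
    [OpensMeasurableSpace X]
    {μs : ℕ → ProbabilityMeasure X} {μ : ProbabilityMeasure X}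
    (h : ∀ B, MeasurableSet B →
      Tendsto (fun n => (μs n : Measure X) B) atTop (𝓝 ((μ : Measure X) B))) :
    Tendsto (fun T : ℕ+ => timeAverage μs T) atTop (𝓝 μ) := by
  refine tendsto_of_forall_isOpen_le_liminf' fun G hG => le_of_eq (Tendsto.liminf_eq ?_).symm
  have h1 : Tendsto (fun n => ((μs n : Measure X) G).toReal) atTop
      (𝓝 ((μ : Measure X) G).toReal) :=
    (ENNReal.tendsto_toReal (measure_ne_top _ _)).comp (h G hG.measurableSet)
  have h2 := (ENNReal.tendsto_ofReal h1.cesaro).comp tendsto_PNat_val_atTop_atTop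
  rw [ENNReal.ofReal_toReal (measure_ne_top _ _)] at h2
  refine h2.congr fun T => ?_
  have hT : (0 : ℝ) < (T : ℕ) := by exact_mod_cast T.pos
  change ENNReal.ofReal (((T : ℕ) : ℝ)⁻¹ * _) =
    (((T : ℕ) : ℝ≥0∞)⁻¹ • ∑ t ∈ Finset.range T, (μs t : Measure X)) G
  rw [ENNReal.ofReal_mul (by positivity), ENNReal.ofReal_inv_of_pos hT, ENNReal.ofReal_natCast,
    ENNReal.ofReal_sum_of_nonneg fun _ _ => ENNReal.toReal_nonneg, Measure.smul_apply, smul_eq_mul,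
    Measure.finsetSum_apply]
  congr 1
  exact Finset.sum_congr rfl fun t _ => ENNReal.ofReal_toReal (measure_ne_top _ _)

end Setwise

/-! ### Transitions of the decision process -/

namespace MDP

variable {S A AP : Type*}

/-- In an ergodic chain, the distributions of the transitions seen along a run of the policy
converge setwise to the stationary one. -/
theorem IsErgodicWith.tendsto_transitionDist [MeasurableSpace S] [MeasurableSpace A]
    {M : MDP S A AP} {π : Kernel S A} [IsMarkovKernel π] {ξ : ProbabilityMeasure S}
    (hξ : M.IsErgodicWith π ξ) (s : S) {B : Set M.Transition} (hB : MeasurableSet B) :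
    Tendsto (fun t => (M.transitionDist π (M.stateDist π t s) : Measure M.Transition) B) atTop
      (𝓝 ((M.transitionDist π ξ : Measure M.Transition) B)) := by
  have hf : Measurable fun x : (S × A) × S => (x.1.1, x.1.2, M.rewardMap x.1, x.2) := by
    have := M.measurable_rewardMap
    fun_prop
  have h₀ : ∀ C, MeasurableSet C → Tendsto (fun t => (M.stateDist π t s : Measure S) C) atTop
      (𝓝 ((ξ : Measure S) C)) := fun C hC => by
    simpa only [ProbabilityMeasure.ennreal_coeFn_eq_coeFn_toMeasure] using
      ENNReal.tendsto_coe.2 (hξ.tendsto s C hC)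
  have h₁ := fun C hC => tendsto_compProd_apply h₀ π (B := C) hC
  have h₂ := tendsto_compProd_apply h₁ M.transition (hf hB)
  have he : ∀ μ : ProbabilityMeasure S, (M.transitionDist π μ : Measure M.Transition) B =
      (((μ : Measure S) ⊗ₘ π) ⊗ₘ M.transition)
        ((fun x : (S × A) × S => (x.1.1, x.1.2, M.rewardMap x.1, x.2)) ⁻¹' B) := fun μ =>
    Measure.map_apply hf hB
  simpa only [he] using h₂

theorem isContinuousPseudoDist_rawDist [PseudoMetricSpace S] [MeasurableSpace S]
    [PseudoMetricSpace A] [MeasurableSpace A] (M : MDP S A AP) [PseudoMetricSpace M.RewardSpace] :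
    IsContinuousPseudoDist (rawDist : M.Transition → M.Transition → ℝ) where
  self x := by simp [rawDist]
  symm x y := by simp [rawDist, dist_comm]
  triangle x y z := by
    have h₁ := dist_triangle x.1 y.1 z.1
    have h₂ := dist_triangle x.2.1 y.2.1 z.2.1
    have h₃ := dist_triangle x.2.2.1 y.2.2.1 z.2.2.1
    have h₄ := dist_triangle x.2.2.2 y.2.2.2 z.2.2.2
    simp only [rawDist]
    linarith
  continuous := by
    unfold rawDist
    fun_prop

end MDP

/-! ### Continuity of the Wasserstein distance and conclusion -/

namespace IsContinuousPseudoDist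

variable {X : Type*} [TopologicalSpace X] [SecondCountableTopology X]
  [MeasurableSpace X] [OpensMeasurableSpace X] {d : X → X → ℝ}

theorem tendsto_wasserstein_of_negligibleMomentTails [HasOuterApproxClosed X]
    (hd : IsContinuousPseudoDist d)
    {μs : ℕ+ → ProbabilityMeasure X} {μ : ProbabilityMeasure X} (hμ : Tendsto μs atTop (𝓝 μ))
    (htail : NegligibleMomentTails d μs) :
    Tendsto (fun T => wasserstein d (μs T) μ) atTop (𝓝 0) := by
  obtain ⟨x₀, hx₀⟩ := htail
  -- The filter on `ℕ+` is countably generated, so sequences suffice; the tail bound is inherited by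
  -- each of them.
  refine tendsto_of_seq_tendsto fun u hu => ?_
  refine hd.tendsto_wasserstein (hμ.comp hu) (x₀ := x₀) fun ε hε => ?_
  obtain ⟨r, hr⟩ := hx₀ ε hε
  exact ⟨r, hu.eventually hr⟩

/-- Measures with finite first moments have finite Wasserstein distance. -/
theorem wasserstein_ne_top (hd : IsContinuousPseudoDist d) {μ ν : ProbabilityMeasure X} {x₀ y₀ : X}
    (hμ : ∫⁻ x, ENNReal.ofReal (d x₀ x) ∂(μ : Measure X) ≠ ∞)
    (hν : ∫⁻ x, ENNReal.ofReal (d y₀ x) ∂(ν : Measure X) ≠ ∞) : wasserstein d μ ν ≠ ∞ := by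
  have hmem : (μ : Measure X).prod (ν : Measure X) ∈ couplings (μ : Measure X) (ν : Measure X) := by
    constructor
    · rw [Measure.map_fst_prod, measure_univ, one_smul]
    · rw [Measure.map_snd_prod, measure_univ, one_smul]
  have hle := hd.inv_mul_lintegral_prod_le (α := μ) (β := ν) measure_univ measure_univ x₀
  rw [inv_one, one_mul] at hle
  refine ne_top_of_le_ne_top (ENNReal.add_ne_top.2 ⟨?_, ?_⟩) ((iInf₂_le _ hmem).trans hle)
  · simpa only [hd.symm x₀] using hμ
  -- The two tail conditions may come with different base points; changing the base point adds a
  -- constant.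
  · have h : ∫⁻ x, ENNReal.ofReal (d x₀ x) ∂(ν : Measure X) ≤
        ∫⁻ x, (ENNReal.ofReal (d x₀ y₀) + ENNReal.ofReal (d y₀ x)) ∂(ν : Measure X) :=
      lintegral_mono fun x => hd.ofReal_triangle _ _ _
    rw [lintegral_add_left measurable_const, lintegral_const, measure_univ, mul_one] at h
    exact ne_top_of_le_ne_top (ENNReal.add_ne_top.2 ⟨ENNReal.ofReal_ne_top, hν⟩) h

/-- The Wasserstein distance is continuous with respect to convergence in itself. -/
theorem tendsto_wasserstein_of_tendsto_zero {ι : Type*} {L : Filter ι}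
    (hd : IsContinuousPseudoDist d) {μs νs : ι → ProbabilityMeasure X}
    {μ ν : ProbabilityMeasure X} (hμ : Tendsto (fun i => wasserstein d (μs i) μ) L (𝓝 0))
    (hν : Tendsto (fun i => wasserstein d (νs i) ν) L (𝓝 0)) (hfin : wasserstein d μ ν ≠ ∞) :
    Tendsto (fun i => wasserstein d (μs i) (νs i)) L (𝓝 (wasserstein d μ ν)) := by
  have h0 := hμ.add hν
  rw [add_zero] at h0
  -- Finiteness of the limit gives continuity of the truncated subtraction in the lower bound.
  have hlo := ENNReal.Tendsto.sub (tendsto_const_nhds (x := wasserstein d μ ν)) h0 (Or.inl hfin)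
  have hhi := (tendsto_const_nhds (x := wasserstein d μ ν)).add h0
  rw [tsub_zero] at hlo
  rw [add_zero] at hhi
  refine tendsto_of_tendsto_of_tendsto_of_le_of_le hlo hhi (fun i => ?_) fun i => ?_
  · refine tsub_le_iff_right.2 ?_
    calc wasserstein d μ ν ≤ wasserstein d μ (μs i) + wasserstein d (μs i) ν :=
          hd.wasserstein_triangle _ _ _
      _ ≤ wasserstein d μ (μs i) + (wasserstein d (μs i) (νs i) + wasserstein d (νs i) ν) := by
          gcongr
          exact hd.wasserstein_triangle _ _ _
      _ = _ := by rw [hd.wasserstein_comm μ]; ring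
  · calc wasserstein d (μs i) (νs i) ≤ wasserstein d (μs i) μ + wasserstein d μ (νs i) :=
          hd.wasserstein_triangle _ _ _
      _ ≤ wasserstein d (μs i) μ + (wasserstein d μ ν + wasserstein d ν (νs i)) := by
          gcongr
          exact hd.wasserstein_triangle _ _ _
      _ = _ := by rw [hd.wasserstein_comm ν]; ring

end IsContinuousPseudoDist

theorem mainTheorem3 {S A AP : Type*}
    [MeasurableSpace S] [MetricSpace S] [SecondCountableTopology S] [BorelSpace S]
    [MeasurableSpace A] [MetricSpace A] [SecondCountableTopology A] [BorelSpace A]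
    (M : MDP S A AP)
    [MetricSpace M.RewardSpace] [SecondCountableTopology M.RewardSpace] [BorelSpace M.RewardSpace]
    (π : Kernel S A) [IsMarkovKernel π]
    (ξ : ProbabilityMeasure S) (hξ : M.IsErgodicWith π ξ)
    (ψ : M.BehavioralModel) (ξψ : ProbabilityMeasure M.Transition)
    (hψ : Tendsto (fun T : ℕ+ => ψ.tracesDist T) atTop (𝓝 ξψ))
    (hψ_tails : NegligibleMomentTails MDP.rawDist fun T : ℕ+ => ψ.tracesDist T)
    (hπ_tails : NegligibleMomentTails MDP.rawDist fun T : ℕ+ => M.tracesDist π T) :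
    wasserstein MDP.rawDist (M.transitionDist π ξ) ξψ ≠ ∞ ∧
    Tendsto (fun T : ℕ+ => wasserstein MDP.rawDist (M.tracesDist π T) (ψ.tracesDist T)) atTop
      (𝓝 (wasserstein MDP.rawDist (M.transitionDist π ξ) ξψ)) := by
  have hd := M.isContinuousPseudoDist_rawDist
  have hπ : Tendsto (fun T : ℕ+ => M.tracesDist π T) atTop (𝓝 (M.transitionDist π ξ)) :=
    tendsto_timeAverage fun B hB =>
      -- The shift is there because the average starts with the state after one step.
      (hξ.tendsto_transitionDist M.init hB).comp (tendsto_add_atTop_nat 1)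
  obtain ⟨x₀, hx₀⟩ := hd.exists_lintegral_ne_top_of_negligibleMomentTails hπ hπ_tails
  obtain ⟨y₀, hy₀⟩ := hd.exists_lintegral_ne_top_of_negligibleMomentTails hψ hψ_tails
  have hfin := hd.wasserstein_ne_top hx₀ hy₀
  exact ⟨hfin, hd.tendsto_wasserstein_of_tendsto_zero
    (hd.tendsto_wasserstein_of_negligibleMomentTails hπ hπ_tails)
    (hd.tendsto_wasserstein_of_negligibleMomentTails hψ hψ_tails) hfin⟩
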